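/- Let $F$ be an algebraically closed field of characteristic $0$, let $m\ge 2$ be an integer and let $\zeta\in F$ be a primitive $m$-th root of unity. Let $H=H_{m^2}(\zeta)$ be the Taft algebra, i.e. the unital $F$-algebra generated by $c,v$ with relations $c^m=1$, $v^m=0$, $vc=\zeta cv$, with comultiplication $\Delta(c)=c\otimes c$, $\Delta(v)=c\otimes v+v\otimes 1$ and counit $\varepsilon(c)=1$, $\varepsilon(v)=0$. An $H$-module Lie algebra is a Lie algebra $L$ over $F$ that is a left $H$-module with $h[a,b]=[h_{(1)}a,h_{(2)}b]$ for all $h\in H$, $a,b\in L$ (where $\Delta h=h_{(1)}\otimes h_{(2)}$ in Sweedler's notation); it is $H$-simple if $[L,L]\ne 0$ and $0$ and $L$ are its only $H$-invariant ideals. Put $L^{(0)}=\{a\in L\mid ca=a\}$. For a Lie algebra $B$ over $F$, let $L(B,0)=\bigoplus_{i=0}^{m-1}\varphi^i(B)$, where $\varphi^0(B)=B$ and each $\varphi^i(B)$ is a copy of the vector space $B$ via a linear bijection $a\mapsto\varphi^i(a)$, with the $H$-action $c\,\varphi^i(a)=\zeta^i\varphi^i(a)$, $v\,\varphi^{i}(a)=\varphi^{i-1}(a)$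 for $1\le i\le m-1$, $v\,\varphi^0(a)=0$, and with the bracket $$[\varphi^k(a),\varphi^\ell(b)]=\begin{cases}\binom{k+\ell}{k}_\zeta\,\varphi^{k+\ell}([a,b]) & \text{if } k+\ell<m,\\ 0 & \text{if } k+\ell\ge m,\end{cases}\qquad a,b\in B,\ 0\le k,\ell<m,$$ where $\binom{n}{k}_\zeta=\frac{n!_\zeta}{(n-k)!_\zeta\,k!_\zeta}$, $n!_\zeta=\prod_{j=1}^n(1+\zeta+\dots+\zeta^{j-1})$. Theorem. Let $L$ be a finite dimensional $H$-simple $H$-module Lie algebra over $F$ whose solvable radical is nonzero. Then there is a finite dimensional simple Lie algebra $B$ over $F$ such that $L$ is isomorphic to $L(B,0)$ as an $H$-module algebra (that is, by an isomorphism of Lie algebras that commutes with the action of $H$), and $L^{(0)}\cong B$ as Lie algebras. Moreover, the solvable radical of $L$ equals its nilpotent radical (the largest nilpotent ideal), and $\{x\in L\mid vx=0\}=L^{(0)}$. -/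

import Mathlib

universe u w

open scoped TensorProduct

noncomputable section

/-! ### Quantum integers, factorials and binomial coefficients -/

section Quantum

variable {F : Type*} [Field F]

/-- The quantum factorial `n!_ζ = n_ζ (n-1)_ζ ⋯ 1_ζ`, where `k_ζ = 1 + ζ + ⋯ + ζ ^ (k-1)`. -/
def qFactorial (ζ : F) (n : ℕ) : F :=
  ∏ j ∈ Finset.range n, ∑ i ∈ Finset.range (j + 1), ζ ^ i

/-- The quantum binomial coefficient `n!_ζ / ((n-k)!_ζ k!_ζ)`. -/
def qBinom (ζ : F) (n k : ℕ) : F :=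
  qFactorial ζ n / (qFactorial ζ (n - k) * qFactorial ζ k)

theorem qFactorial_succ (ζ : F) (n : ℕ) :
    qFactorial ζ (n + 1) = qFactorial ζ n * ∑ i ∈ Finset.range (n + 1), ζ ^ i :=
  Finset.prod_range_succ _ _

theorem qFactorial_ne_zero {ζ : F} {m : ℕ} (hζ : IsPrimitiveRoot ζ m) {n : ℕ} (hn : n < m) :
    qFactorial ζ n ≠ 0 := by
  refine Finset.prod_ne_zero_iff.2 fun j hj h => ?_
  have hj' : j + 1 < m := by have := Finset.mem_range.1 hj; omega
  have h1 : ζ ^ (j + 1) = 1 := by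
    have := geom_sum_mul ζ (j + 1)
    rw [h, zero_mul] at this
    exact (sub_eq_zero.1 this.symm)
  exact hζ.pow_ne_one_of_pos_of_lt (Nat.succ_ne_zero j) hj' h1

/-- Coefficients of `(X + Y) ^ n` when `Y X = ζ X Y`, via the quantum Pascal rule. -/
def qPascal (ζ : F) : ℕ → ℕ → F
  | _, 0 => 1
  | 0, _ + 1 => 0
  | n + 1, k + 1 => qPascal ζ n k + ζ ^ (k + 1) * qPascal ζ n (k + 1)

theorem qPascal_zero_right (ζ : F) (n : ℕ) : qPascal ζ n 0 = 1 := by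
  cases n <;> rfl

theorem qPascal_of_lt (ζ : F) : ∀ n k : ℕ, n < k → qPascal ζ n k = 0
  | _, 0, h => absurd h (Nat.not_lt_zero _)
  | 0, _ + 1, _ => rfl
  | n + 1, k + 1, h => by
    rw [qPascal, qPascal_of_lt ζ n k (by omega), qPascal_of_lt ζ n (k + 1) (by omega)]
    simp

theorem qPascal_mul (ζ : F) : ∀ n a b : ℕ, a + b = n →
    qPascal ζ n a * (qFactorial ζ a * qFactorial ζ b) = qFactorial ζ n
  | n, 0, b, h => by
    obtain rfl : b = n := by omega
    simp [qPascal_zero_right, qFactorial]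
  | 0, a + 1, b, h => by omega
  | n + 1, a + 1, 0, h => by
    obtain rfl : a = n := by omega
    have h1 := qPascal_mul ζ a a 0 rfl
    rw [qPascal, qPascal_of_lt ζ a (a + 1) (by omega), qFactorial_succ]
    linear_combination (∑ i ∈ Finset.range (a + 1), ζ ^ i) * h1
  | n + 1, a + 1, b + 1, h => by
    have h1 := qPascal_mul ζ n a (b + 1) (by omega)
    have h2 := qPascal_mul ζ n (a + 1) b (by omega)
    have h3 : ∑ i ∈ Finset.range (n + 1), ζ ^ i = (∑ i ∈ Finset.range (a + 1), ζ ^ i)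
        + ζ ^ (a + 1) * ∑ i ∈ Finset.range (b + 1), ζ ^ i := by
      obtain rfl : n = a + 1 + b := by omega
      rw [add_assoc (a + 1), Finset.sum_range_add, Finset.mul_sum]
      simp [pow_add]
    rw [qPascal, qFactorial_succ ζ n, h3]
    rw [qFactorial_succ ζ a] at h2 ⊢
    rw [qFactorial_succ ζ b] at h1 ⊢
    linear_combination (∑ i ∈ Finset.range (a + 1), ζ ^ i) * h1 +
      (ζ ^ (a + 1) * ∑ i ∈ Finset.range (b + 1), ζ ^ i) * h2

theorem qCommute_pow {A : Type*} [Ring A] [Algebra F A] (ζ : F) {X Y : A}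
    (h : Y * X = ζ • (X * Y)) (k : ℕ) : Y * X ^ k = ζ ^ k • (X ^ k * Y) := by
  induction k with
  | zero => simp
  | succ k ih =>
    rw [pow_succ, ← mul_assoc, ih, smul_mul_assoc, mul_assoc, h, mul_smul_comm, smul_smul,
      ← pow_succ, ← mul_assoc]

theorem qCommute_add_pow {A : Type*} [Ring A] [Algebra F A] (ζ : F) {X Y : A}
    (h : Y * X = ζ • (X * Y)) (n : ℕ) :
    (X + Y) ^ n = ∑ k ∈ Finset.range (n + 1), qPascal ζ n k • (X ^ k * Y ^ (n - k)) := by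
  induction n with
  | zero => simp [qPascal_zero_right]
  | succ n ih =>
    rw [pow_succ', ih, add_mul, Finset.mul_sum, Finset.mul_sum,
      Finset.sum_range_succ' _ (n + 1)]
    have e1 : ∀ k ∈ Finset.range (n + 1),
        qPascal ζ (n + 1) (k + 1) • (X ^ (k + 1) * Y ^ (n + 1 - (k + 1))) =
        X * (qPascal ζ n k • (X ^ k * Y ^ (n - k))) +
        (ζ ^ (k + 1) * qPascal ζ n (k + 1)) • (X ^ (k + 1) * Y ^ (n - k)) := by
      intro k _
      rw [qPascal, add_smul, mul_smul_comm, ← mul_assoc, ← pow_succ', Nat.add_sub_add_right]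
    have e2 : ∀ k ∈ Finset.range (n + 1), Y * (qPascal ζ n k • (X ^ k * Y ^ (n - k))) =
        (ζ ^ k * qPascal ζ n k) • (X ^ k * Y ^ (n + 1 - k)) := by
      intro k hk
      have hk' := Finset.mem_range.1 hk
      rw [mul_smul_comm, ← mul_assoc, qCommute_pow ζ h, smul_mul_assoc, smul_smul, mul_assoc,
        ← pow_succ', mul_comm, show n - k + 1 = n + 1 - k by omega]
    rw [Finset.sum_congr rfl e1, Finset.sum_congr rfl e2, Finset.sum_add_distrib, add_assoc]
    congr 1
    rw [Finset.sum_range_succ', Finset.sum_range_succ (fun k =>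
      (ζ ^ (k + 1) * qPascal ζ n (k + 1)) • (X ^ (k + 1) * Y ^ (n - k))),
      qPascal_of_lt ζ n (n + 1) (by omega)]
    simp [qPascal_zero_right]

theorem qCommute_add_pow_eq_zero {A : Type*} [Ring A] [Algebra F A] {ζ : F} {m : ℕ}
    (hζ : IsPrimitiveRoot ζ m) {X Y : A} (h : Y * X = ζ • (X * Y)) (hX : X ^ m = 0)
    (hY : Y ^ m = 0) : (X + Y) ^ m = 0 := by
  rw [qCommute_add_pow ζ h]
  refine Finset.sum_eq_zero fun k hk => ?_
  have hk' : k ≤ m := by have := Finset.mem_range.1 hk; omega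
  rcases Nat.eq_zero_or_pos k with rfl | h0
  · simp [hY]
  rcases hk'.eq_or_lt with rfl | h1
  · simp [hX]
  have hm := qPascal_mul ζ m k (m - k) (by omega)
  have hz : qFactorial ζ m = 0 := by
    obtain ⟨n, rfl⟩ : ∃ n, m = n + 1 := ⟨m - 1, by omega⟩
    rw [qFactorial_succ, hζ.geom_sum_eq_zero (by omega), mul_zero]
  rw [hz] at hm
  have hne := mul_ne_zero (qFactorial_ne_zero hζ h1)
    (qFactorial_ne_zero hζ (show m - k < m by omega))
  rw [(mul_eq_zero.1 hm).resolve_right hne, zero_smul]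

end Quantum

/-! ### The Taft algebra -/

/-- The two generators of a Taft algebra. -/
inductive TaftGen : Type
  | c : TaftGen
  | v : TaftGen

/-- The relations `c ^ m = 1`, `v ^ m = 0`, `v c = ζ c v`. -/
inductive TaftRel {F : Type*} [Field F] (m : ℕ) (ζ : F) :
    FreeAlgebra F TaftGen → FreeAlgebra F TaftGen → Prop
  | c_pow : TaftRel m ζ (FreeAlgebra.ι F TaftGen.c ^ m) 1
  | v_pow : TaftRel m ζ (FreeAlgebra.ι F TaftGen.v ^ m) 0
  | v_mul_c : TaftRel m ζ (FreeAlgebra.ι F TaftGen.v * FreeAlgebra.ι F TaftGen.c)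
      (ζ • (FreeAlgebra.ι F TaftGen.c * FreeAlgebra.ι F TaftGen.v))

/-- The Taft algebra `H_{m²}(ζ)`: the unital algebra generated by `c` and `v` subject to
`c ^ m = 1`, `v ^ m = 0`, `v c = ζ c v`. -/
def TaftAlgebra {F : Type*} [Field F] (m : ℕ) (ζ : F) : Type _ := RingQuot (TaftRel m ζ)

namespace TaftAlgebra

variable {F : Type*} [Field F] (m : ℕ) (ζ : F)

instance instRing : Ring (TaftAlgebra m ζ) := inferInstanceAs (Ring (RingQuot (TaftRel m ζ)))

instance instAlgebra : Algebra F (TaftAlgebra m ζ) :=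
  inferInstanceAs (Algebra F (RingQuot (TaftRel m ζ)))

/-- The quotient map from the free algebra. -/
def mk : FreeAlgebra F TaftGen →ₐ[F] TaftAlgebra m ζ := RingQuot.mkAlgHom F (TaftRel m ζ)

/-- The generator `c`. -/
def c : TaftAlgebra m ζ := mk m ζ (FreeAlgebra.ι F TaftGen.c)

/-- The generator `v`. -/
def v : TaftAlgebra m ζ := mk m ζ (FreeAlgebra.ι F TaftGen.v)

theorem c_pow : c m ζ ^ m = 1 := by
  have := RingQuot.mkAlgHom_rel F (TaftRel.c_pow (m := m) (ζ := ζ))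
  rw [map_pow, map_one] at this
  exact this

theorem v_pow : v m ζ ^ m = 0 := by
  have := RingQuot.mkAlgHom_rel F (TaftRel.v_pow (m := m) (ζ := ζ))
  rw [map_pow, map_zero] at this
  exact this

theorem v_mul_c : v m ζ * c m ζ = ζ • (c m ζ * v m ζ) := by
  have := RingQuot.mkAlgHom_rel F (TaftRel.v_mul_c (m := m) (ζ := ζ))
  rw [map_mul, map_smul, map_mul] at this
  exact this

variable {m ζ} {A : Type*} [Ring A] [Algebra F A]

/-- The universal property of the Taft algebra. -/
def lift (x y : A) (hx : x ^ m = 1) (hy : y ^ m = 0) (hyx : y * x = ζ • (x * y)) :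
    TaftAlgebra m ζ →ₐ[F] A :=
  RingQuot.liftAlgHom F ⟨FreeAlgebra.lift F (fun g => TaftGen.rec x y g), by
    rintro _ _ (_ | _ | _)
    · simpa using hx
    · simpa using hy
    · simpa using hyx⟩

@[simp]
theorem lift_c (x y : A) (hx : x ^ m = 1) (hy : y ^ m = 0) (hyx : y * x = ζ • (x * y)) :
    lift x y hx hy hyx (c m ζ) = x := by
  refine (RingQuot.liftAlgHom_mkAlgHom_apply F _ _ _).trans ?_
  simp

@[simp]
theorem lift_v (x y : A) (hx : x ^ m = 1) (hy : y ^ m = 0) (hyx : y * x = ζ • (x * y)) :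
    lift x y hx hy hyx (v m ζ) = y := by
  refine (RingQuot.liftAlgHom_mkAlgHom_apply F _ _ _).trans ?_
  simp

theorem algHom_ext {f g : TaftAlgebra m ζ →ₐ[F] A} (hc : f (c m ζ) = g (c m ζ))
    (hv : f (v m ζ) = g (v m ζ)) : f = g := by
  refine RingQuot.ringQuot_ext' F f g (FreeAlgebra.hom_ext (funext fun x => ?_))
  cases x
  · exact hc
  · exact hv

variable (m ζ)

/-- The comultiplication: `Δ c = c ⊗ c` and `Δ v = c ⊗ v + v ⊗ 1`. -/
def comulHom [hζ : Fact (IsPrimitiveRoot ζ m)] :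
    TaftAlgebra m ζ →ₐ[F] TaftAlgebra m ζ ⊗[F] TaftAlgebra m ζ :=
  lift (c m ζ ⊗ₜ[F] c m ζ) (c m ζ ⊗ₜ[F] v m ζ + v m ζ ⊗ₜ[F] 1)
    (by rw [Algebra.TensorProduct.tmul_pow, c_pow]; rfl)
    (by
      refine qCommute_add_pow_eq_zero hζ.out ?_ ?_ ?_
      · simp only [Algebra.TensorProduct.tmul_mul_tmul, v_mul_c, one_mul, mul_one,
          TensorProduct.smul_tmul']
      · rw [Algebra.TensorProduct.tmul_pow, v_pow, TensorProduct.tmul_zero]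
      · rw [Algebra.TensorProduct.tmul_pow, v_pow, TensorProduct.zero_tmul])
    (by
      simp only [add_mul, mul_add, smul_add, Algebra.TensorProduct.tmul_mul_tmul, v_mul_c,
        one_mul, mul_one, TensorProduct.smul_tmul', TensorProduct.tmul_smul])

/-- The counit: `ε c = 1` and `ε v = 0`. -/
def counitHom [NeZero m] : TaftAlgebra m ζ →ₐ[F] F :=
  lift 1 0 (one_pow m) (zero_pow (NeZero.ne m)) (by simp)

/-- The bialgebra structure on the Taft algebra. -/
instance instBialgebra [NeZero m] [Fact (IsPrimitiveRoot ζ m)] : Bialgebra F (TaftAlgebra m ζ) :=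
  Bialgebra.ofAlgHom (comulHom m ζ) (counitHom m ζ)
    (by
      refine algHom_ext ?_ ?_
      · simp [comulHom]
      · simp [comulHom, TensorProduct.tmul_add, TensorProduct.add_tmul, add_assoc,
          Algebra.TensorProduct.one_def])
    (by
      refine algHom_ext ?_ ?_
      · simp [comulHom, counitHom]
      · simp [comulHom, counitHom])
    (by
      refine algHom_ext ?_ ?_
      · simp [comulHom, counitHom]
      · simp [comulHom, counitHom])

@[simp]
theorem comul_c [NeZero m] [Fact (IsPrimitiveRoot ζ m)] :
    Coalgebra.comul (R := F) (c m ζ) = c m ζ ⊗ₜ[F] c m ζ :=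
  lift_c _ _ _ _ _

@[simp]
theorem comul_v [NeZero m] [Fact (IsPrimitiveRoot ζ m)] :
    Coalgebra.comul (R := F) (v m ζ) = c m ζ ⊗ₜ[F] v m ζ + v m ζ ⊗ₜ[F] 1 :=
  lift_v _ _ _ _ _

end TaftAlgebra

/-! ### Module Lie algebras over a bialgebra -/

section ModuleLie

variable (F H L : Type*) [Field F] [Ring H] [Bialgebra F H] [LieRing L] [LieAlgebra F L]
  [Module H L] [IsScalarTower F H L]

variable {F H L} in
/-- For `a b : L`, the linear map `h₁ ⊗ h₂ ↦ [h₁ a, h₂ b]`. -/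
def tensorBracket (a b : L) : H ⊗[F] H →ₗ[F] L :=
  TensorProduct.lift (LinearMap.mk₂ F (fun h₁ h₂ : H => ⁅h₁ • a, h₂ • b⁆)
    (fun x y z => by rw [add_smul, add_lie])
    (fun r x z => by rw [smul_assoc, smul_lie])
    (fun x y z => by rw [add_smul, lie_add])
    (fun r x z => by rw [smul_assoc, lie_smul]))

/-- `L` is an `H`-module Lie algebra: `h [a, b] = [h₍₁₎ a, h₍₂₎ b]` for all `h`, `a`, `b`. -/
class IsModuleLieAlgebra : Prop where
  smul_lie_eq : ∀ (h : H) (a b : L),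
    h • ⁅a, b⁆ = tensorBracket a b (Coalgebra.comul (R := F) h)

/-- `L` is `H`-simple: `[L, L] ≠ 0` and the only `H`-invariant ideals are `0` and `L`. -/
structure IsHSimple : Prop where
  non_abelian : ¬ IsLieAbelian L
  eq_bot_or_eq_top : ∀ I : LieIdeal F L, (∀ (h : H), ∀ x ∈ I, h • x ∈ I) → I = ⊥ ∨ I = ⊤

end ModuleLie

/-- The nilpotent radical of a Lie algebra: the sum of all ideals that are nilpotent as Lie
algebras. (In contrast, `LieAlgebra.maxNilpotentIdeal` asks for nilpotency of the action of the
whole algebra on the ideal.) -/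
def lieNilradical (F L : Type*) [CommRing F] [LieRing L] [LieAlgebra F L] : LieIdeal F L :=
  sSup {I : LieIdeal F L | LieRing.IsNilpotent I}

/-- The component `L⁽⁰⁾ = {a | c a = a}` of the grading defined by the action of `c`. -/
def TaftAlgebra.degreeZero {F : Type*} [Field F] (m : ℕ) [NeZero m] (ζ : F)
    [Fact (IsPrimitiveRoot ζ m)] (L : Type*) [LieRing L] [LieAlgebra F L]
    [Module (TaftAlgebra m ζ) L] [IsScalarTower F (TaftAlgebra m ζ) L]
    [IsModuleLieAlgebra F (TaftAlgebra m ζ) L] : LieSubalgebra F L where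
  carrier := {a | TaftAlgebra.c m ζ • a = a}
  add_mem' {a b} ha hb := by
    rw [Set.mem_ofPred_eq] at *
    rw [smul_add, ha, hb]
  zero_mem' := smul_zero _
  smul_mem' r a ha := by
    rw [Set.mem_ofPred_eq] at *
    rw [← algebraMap_smul (TaftAlgebra m ζ) r a, smul_smul, ← Algebra.commutes, ← smul_smul, ha]
  lie_mem' {a b} ha hb := by
    change TaftAlgebra.c m ζ • a = a at ha
    change TaftAlgebra.c m ζ • b = b at hb
    change TaftAlgebra.c m ζ • ⁅a, b⁆ = ⁅a, b⁆
    rw [IsModuleLieAlgebra.smul_lie_eq (F := F), TaftAlgebra.comul_c]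
    simp [tensorBracket, ha, hb]

/-! ### The algebras `L(B, γ)` -/

/-- The space `L(B, γ) = ⨁_{0 ≤ i < m} L⁽ⁱ⁾`, where every `L⁽ⁱ⁾` is a copy of `B`. An element is
given by its components, a function `Fin m → B`; for `a : B`, the function supported at `i` with
value `a` is the element `φⁱ(a)` of `L⁽ⁱ⁾`. -/
@[ext]
structure TaftLie {F : Type*} [Field F] (m : ℕ) (ζ : F) (B : Type*) (γ : F) where
  /-- The components of an element. -/
  coord : Fin m → B

namespace TaftLie

section Space

variable {F : Type*} [Field F] (m : ℕ) (ζ : F) (B : Type*) (γ : F)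

instance instCoeFun : CoeFun (TaftLie m ζ B γ) (fun _ => Fin m → B) := ⟨coord⟩

/-- An element is the same as its family of components. -/
def coordEquiv : TaftLie m ζ B γ ≃ (Fin m → B) where
  toFun f := f.coord
  invFun f := ⟨f⟩

instance instAddCommGroup [AddCommGroup B] : AddCommGroup (TaftLie m ζ B γ) :=
  (coordEquiv m ζ B γ).addCommGroup

instance instModule [AddCommGroup B] [Module F B] : Module F (TaftLie m ζ B γ) :=
  (coordEquiv m ζ B γ).module F

variable {B} in
/-- The element `φᵏ(a)`. -/
def phi [AddCommGroup B] (k : Fin m) (a : B) : TaftLie m ζ B γ := ⟨Pi.single k a⟩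

variable {m ζ B γ}

theorem ext_apply {f g : TaftLie m ζ B γ} (h : ∀ i, f i = g i) : f = g := TaftLie.ext (funext h)

@[simp] theorem add_apply [AddCommGroup B] (f g : TaftLie m ζ B γ) (i : Fin m) :
    (f + g) i = f i + g i := rfl
@[simp] theorem neg_apply [AddCommGroup B] (f : TaftLie m ζ B γ) (i : Fin m) :
    (-f) i = -f i := rfl
@[simp] theorem zero_apply [AddCommGroup B] (i : Fin m) : (0 : TaftLie m ζ B γ) i = 0 := rfl
@[simp] theorem smul_apply [AddCommGroup B] [Module F B] (r : F) (f : TaftLie m ζ B γ)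
    (i : Fin m) : (r • f) i = r • f i := rfl

end Space

variable {F : Type*} [Field F] (m : ℕ) (ζ : F) (B : Type*) [LieRing B] [LieAlgebra F B] (γ : F)

/-- The action of `c`: multiplication by `ζⁱ` on `L⁽ⁱ⁾`. -/
def cAct : Module.End F (TaftLie m ζ B γ) where
  toFun f := ⟨fun i => ζ ^ (i : ℕ) • f i⟩
  map_add' f g := by ext i; simp
  map_smul' r f := by ext i; simp [smul_comm r]

/-- The action of `v`: `v φᵏ⁺¹(a) = φᵏ(a)` and `v φ⁰(a) = 0`. -/
def vAct : Module.End F (TaftLie m ζ B γ) where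
  toFun f := ⟨fun i => if h : (i : ℕ) + 1 < m then f ⟨i + 1, h⟩ else 0⟩
  map_add' f g := by ext i; simp only [add_apply]; split <;> simp
  map_smul' r f := by ext i; simp only [smul_apply]; split <;> simp

@[simp] theorem cAct_apply (f : TaftLie m ζ B γ) (i : Fin m) :
    cAct m ζ B γ f i = ζ ^ (i : ℕ) • f i := rfl

theorem vAct_apply (f : TaftLie m ζ B γ) (i : Fin m) :
    vAct m ζ B γ f i = if h : (i : ℕ) + 1 < m then f ⟨i + 1, h⟩ else 0 := rfl

theorem cAct_pow_apply (n : ℕ) (f : TaftLie m ζ B γ) (i : Fin m) :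
    (cAct m ζ B γ ^ n) f i = (ζ ^ (i : ℕ)) ^ n • f i := by
  induction n generalizing f with
  | zero => simp
  | succ n ih => rw [pow_succ, Module.End.mul_apply, ih, cAct_apply, smul_smul, pow_succ]

theorem vAct_pow_apply (n : ℕ) (f : TaftLie m ζ B γ) (i : Fin m) :
    (vAct m ζ B γ ^ n) f i = if h : (i : ℕ) + n < m then f ⟨i + n, h⟩ else 0 := by
  induction n generalizing f with
  | zero => simp
  | succ n ih =>
    rw [pow_succ, Module.End.mul_apply, ih]
    simp only [vAct_apply, add_assoc]
    split_ifs with h1 h2 <;> first | rfl | omega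

/-- The action of the Taft algebra on `L(B, γ)`. -/
def action [hζ : Fact (IsPrimitiveRoot ζ m)] :
    TaftAlgebra m ζ →ₐ[F] Module.End F (TaftLie m ζ B γ) :=
  TaftAlgebra.lift (cAct m ζ B γ) (vAct m ζ B γ)
    (by
      ext f i
      rw [cAct_pow_apply, ← pow_mul, mul_comm, pow_mul, hζ.out.pow_eq_one]
      simp)
    (by
      ext f i
      rw [vAct_pow_apply]
      simp)
    (by
      ext f i
      simp only [Module.End.mul_apply, vAct_apply, cAct_apply, LinearMap.smul_apply, smul_apply]
      split_ifs
      · rw [smul_smul, pow_succ']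
      · simp)

instance instModuleTaft [Fact (IsPrimitiveRoot ζ m)] :
    Module (TaftAlgebra m ζ) (TaftLie m ζ B γ) :=
  Module.compHom _ (action m ζ B γ).toRingHom

instance instIsScalarTower [Fact (IsPrimitiveRoot ζ m)] :
    IsScalarTower F (TaftAlgebra m ζ) (TaftLie m ζ B γ) where
  smul_assoc r h f := by
    change action m ζ B γ (r • h) f = r • action m ζ B γ h f
    rw [map_smul, LinearMap.smul_apply]

theorem c_smul_apply [Fact (IsPrimitiveRoot ζ m)] (f : TaftLie m ζ B γ) (i : Fin m) :
    (TaftAlgebra.c m ζ • f) i = ζ ^ (i : ℕ) • f i := by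
  change action m ζ B γ _ f i = _
  simp [action]

theorem v_smul_apply [Fact (IsPrimitiveRoot ζ m)] (f : TaftLie m ζ B γ) (i : Fin m) :
    (TaftAlgebra.v m ζ • f) i = if h : (i : ℕ) + 1 < m then f ⟨i + 1, h⟩ else 0 := by
  change action m ζ B γ _ f i = _
  simp [action, vAct_apply]

variable {m} in
/-- The scalar `s` with `[φᵏ(a), φˡ(b)]⁽ⁱ⁾ = s φⁱ[a, b]`. -/
def coeff (k l i : Fin m) : F :=
  if (k : ℕ) + l = i then qBinom ζ (k + l) k
  else if (k : ℕ) + l = i + m then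
    γ * (qFactorial ζ (k + l - m) / (qFactorial ζ k * qFactorial ζ l))
  else 0

variable {m} in
theorem coeff_eq (k l i : Fin m) : coeff ζ γ k l i =
    (if (k : ℕ) + l = i then 1 else if (k : ℕ) + l = i + m then γ else 0) *
      (qFactorial ζ i / (qFactorial ζ k * qFactorial ζ l)) := by
  unfold coeff qBinom
  split_ifs with h1 h2
  · rw [h1, show (i : ℕ) - k = l by omega, one_mul, mul_comm (qFactorial ζ l)]
  · rw [h2, Nat.add_sub_cancel]
  · rw [zero_mul]

variable {m} in
theorem coeff_comm (k l i : Fin m) : coeff ζ γ k l i = coeff ζ γ l k i := by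
  rw [coeff_eq, coeff_eq, add_comm (k : ℕ), mul_comm (qFactorial ζ k)]

variable {m} in
/-- The structure constants of iterated brackets. -/
def coeffThree (k l n i : Fin m) : F :=
  (if (k : ℕ) + l + n = i then 1 else if (k : ℕ) + l + n = i + m then γ
      else if (k : ℕ) + l + n = i + m + m then γ * γ else 0) *
    (qFactorial ζ i / (qFactorial ζ k * qFactorial ζ l * qFactorial ζ n))

variable {m} in
theorem coeffThree_swap (k l n i : Fin m) : coeffThree ζ γ l k n i = coeffThree ζ γ k l n i := by
  unfold coeffThree
  rw [add_comm (l : ℕ), mul_comm (qFactorial ζ l)]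

variable {m} in
theorem coeffThree_rotate (k l n i : Fin m) :
    coeffThree ζ γ n k l i = coeffThree ζ γ k l n i := by
  unfold coeffThree
  rw [show (n : ℕ) + k + l = k + l + n by omega, show qFactorial ζ n * qFactorial ζ k *
    qFactorial ζ l = qFactorial ζ k * qFactorial ζ l * qFactorial ζ n by ring]

variable {m} in
theorem sum_coeff (hζ : IsPrimitiveRoot ζ m) (k l n i : Fin m) :
    ∑ p, coeff ζ γ k p i * coeff ζ γ l n p =
      coeffThree ζ γ k l n i := by
  unfold coeffThree
  have key : ∀ p : Fin m, (∀ q : Fin m, q ≠ p → coeff ζ γ l n q = 0) →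
      ∑ p, coeff ζ γ k p i * coeff ζ γ l n p = coeff ζ γ k p i * coeff ζ γ l n p := by
    intro p hp
    refine Finset.sum_eq_single p (fun q _ hq => ?_) (fun h => absurd (Finset.mem_univ _) h)
    rw [hp q hq, mul_zero]
  have hk := k.2
  have hl := l.2
  have hn := n.2
  have hi := i.2
  have fk := qFactorial_ne_zero hζ hk
  have fl := qFactorial_ne_zero hζ hl
  have fn := qFactorial_ne_zero hζ hn
  by_cases h : (l : ℕ) + n < m
  · rw [key ⟨l + n, h⟩]
    · have fp := qFactorial_ne_zero hζ h
      rw [coeff_eq, coeff_eq]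
      simp only [if_true]
      rw [show (k : ℕ) + (l + n) = k + l + n by omega]
      split_ifs <;> first | omega | (simp only [zero_mul]) | (field_simp)
    · intro q hq
      have hq' : (q : ℕ) ≠ l + n := fun e => hq (Fin.ext e)
      have hq2 := q.2
      rw [coeff_eq, if_neg (by omega), if_neg (by omega), zero_mul]
  · have h' : (l : ℕ) + n - m < m := by omega
    rw [key ⟨l + n - m, h'⟩]
    · have fp := qFactorial_ne_zero hζ h'
      rw [coeff_eq, coeff_eq]
      simp only
      rw [if_neg (show ¬ (l : ℕ) + n = l + n - m by omega),
        if_pos (show (l : ℕ) + n = l + n - m + m by omega)]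
      split_ifs <;> first | omega | (simp only [zero_mul]) | (field_simp)
    · intro q hq
      have hq' : (q : ℕ) ≠ l + n - m := fun e => hq (Fin.ext e)
      have hq2 := q.2
      rw [coeff_eq, if_neg (by omega), if_neg (by omega), zero_mul]

instance instBracket : Bracket (TaftLie m ζ B γ) (TaftLie m ζ B γ) where
  bracket f g := ⟨fun i => ∑ k, ∑ l, coeff ζ γ k l i • ⁅f k, g l⁆⟩

variable {m ζ B γ}

theorem lie_apply (f g : TaftLie m ζ B γ) (i : Fin m) :
    ⁅f, g⁆ i = ∑ k, ∑ l, coeff ζ γ k l i • ⁅f k, g l⁆ := rfl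

variable (m ζ B γ)

theorem lie_lie_apply (hζ : IsPrimitiveRoot ζ m) (f g h : TaftLie m ζ B γ) (i : Fin m) :
    ⁅f, ⁅g, h⁆⁆ i = ∑ k : Fin m, ∑ l : Fin m, ∑ n : Fin m,
      coeffThree ζ γ k l n i • ⁅f k, ⁅g l, h n⁆⁆ := by
  rw [lie_apply]
  refine Finset.sum_congr rfl fun k _ => ?_
  simp only [lie_apply, lie_sum, lie_smul, Finset.smul_sum, smul_smul]
  rw [Finset.sum_comm]
  refine Finset.sum_congr rfl fun l _ => ?_
  rw [Finset.sum_comm]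
  refine Finset.sum_congr rfl fun n _ => ?_
  rw [← Finset.sum_smul, sum_coeff ζ γ hζ]

theorem lie_skew_aux (f g : TaftLie m ζ B γ) : ⁅f, g⁆ = -⁅g, f⁆ := by
  ext i
  change ⁅f, g⁆ i = -(⁅g, f⁆ i)
  rw [lie_apply, lie_apply, Finset.sum_comm, ← Finset.sum_neg_distrib]
  refine Finset.sum_congr rfl fun k _ => ?_
  rw [← Finset.sum_neg_distrib]
  refine Finset.sum_congr rfl fun l _ => ?_
  rw [coeff_comm, ← lie_skew, smul_neg]

theorem jacobi_aux (hζ : IsPrimitiveRoot ζ m) (f g h : TaftLie m ζ B γ) :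
    ⁅f, ⁅g, h⁆⁆ = ⁅⁅f, g⁆, h⁆ + ⁅g, ⁅f, h⁆⁆ := by
  rw [lie_skew_aux m ζ B γ ⁅f, g⁆ h]
  ext i
  change ⁅f, ⁅g, h⁆⁆ i = -(⁅h, ⁅f, g⁆⁆ i) + ⁅g, ⁅f, h⁆⁆ i
  rw [lie_lie_apply m ζ B γ hζ f g h, lie_lie_apply m ζ B γ hζ h f g,
    lie_lie_apply m ζ B γ hζ g f h]
  have e1 : ∑ k : Fin m, ∑ l : Fin m, ∑ n : Fin m, coeffThree ζ γ k l n i • ⁅h k, ⁅f l, g n⁆⁆ =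
      ∑ k : Fin m, ∑ l : Fin m, ∑ n : Fin m, coeffThree ζ γ k l n i • ⁅h n, ⁅f k, g l⁆⁆ := by
    rw [Finset.sum_comm]
    refine Finset.sum_congr rfl fun k _ => ?_
    rw [Finset.sum_comm]
    refine Finset.sum_congr rfl fun l _ => Finset.sum_congr rfl fun n _ => ?_
    rw [coeffThree_rotate]
  have e2 : ∑ k : Fin m, ∑ l : Fin m, ∑ n : Fin m, coeffThree ζ γ k l n i • ⁅g k, ⁅f l, h n⁆⁆ =
      ∑ k : Fin m, ∑ l : Fin m, ∑ n : Fin m, coeffThree ζ γ k l n i • ⁅g l, ⁅f k, h n⁆⁆ := by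
    rw [Finset.sum_comm]
    refine Finset.sum_congr rfl fun k _ => Finset.sum_congr rfl fun l _ =>
      Finset.sum_congr rfl fun n _ => ?_
    rw [coeffThree_swap]
  rw [e1, e2]
  simp only [← Finset.sum_neg_distrib, ← Finset.sum_add_distrib, ← smul_neg, ← smul_add]
  refine Finset.sum_congr rfl fun k _ => Finset.sum_congr rfl fun l _ =>
    Finset.sum_congr rfl fun n _ => ?_
  rw [lie_skew, ← leibniz_lie]

instance instLieRing [hζ : Fact (IsPrimitiveRoot ζ m)] : LieRing (TaftLie m ζ B γ) where
  add_lie f g h := by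
    ext i
    simp only [lie_apply, add_apply, add_lie, smul_add, Finset.sum_add_distrib]
  lie_add f g h := by
    ext i
    simp only [lie_apply, add_apply, lie_add, smul_add, Finset.sum_add_distrib]
  lie_self f := by
    ext i
    rw [lie_apply, zero_apply, ← Finset.sum_product']
    refine Finset.sum_involution (fun p _ => p.swap) (fun p _ => ?_) (fun p _ hp he => hp ?_)
      (fun p _ => Finset.mem_product.2 ⟨Finset.mem_univ _, Finset.mem_univ _⟩)
      (fun p _ => Prod.swap_swap p)
    · rw [Prod.fst_swap, Prod.snd_swap, coeff_comm, ← smul_add, ← lie_skew, neg_add_cancel,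
        smul_zero]
    · have : p.2 = p.1 := congrArg Prod.fst he
      rw [this, lie_self, smul_zero]
  leibniz_lie f g h := jacobi_aux m ζ B γ hζ.out f g h

instance instLieAlgebra [Fact (IsPrimitiveRoot ζ m)] : LieAlgebra F (TaftLie m ζ B γ) where
  lie_smul r f g := by
    ext i
    simp only [lie_apply, smul_apply, lie_smul, Finset.smul_sum]
    exact Finset.sum_congr rfl fun k _ => Finset.sum_congr rfl fun l _ => smul_comm _ _ _

variable {B} in
theorem phi_lie_phi_apply (k l : Fin m) (a b : B) (i : Fin m) :
    ⁅phi m ζ γ k a, phi m ζ γ l b⁆ i = coeff ζ γ k l i • ⁅a, b⁆ := by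
  rw [lie_apply, Finset.sum_eq_single k, Finset.sum_eq_single l]
  · simp [phi]
  · intro q _ hq
    simp [phi, Pi.single_eq_of_ne hq]
  · intro h
    exact absurd (Finset.mem_univ _) h
  · intro q _ hq
    simp [phi, Pi.single_eq_of_ne hq]
  · intro h
    exact absurd (Finset.mem_univ _) h

variable {B} in
/-- `[φᵏ(a), φˡ(b)] = binom(k+l, k)_ζ φᵏ⁺ˡ[a, b]` for `k + l < m`. -/
theorem phi_lie_phi_of_lt (k l : Fin m) (a b : B) (h : (k : ℕ) + l < m) :
    ⁅phi m ζ γ k a, phi m ζ γ l b⁆ = qBinom ζ (k + l) k • phi m ζ γ ⟨k + l, h⟩ ⁅a, b⁆ := by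
  ext i
  rw [phi_lie_phi_apply, smul_apply, coeff]
  have hi := i.2
  by_cases hi' : (k : ℕ) + l = i
  · obtain rfl : i = ⟨k + l, h⟩ := Fin.ext hi'.symm
    simp [phi]
  · rw [if_neg hi', if_neg (by omega), zero_smul]
    simp only [phi]
    rw [Pi.single_eq_of_ne (fun e => hi' (by rw [e])), smul_zero]

variable {B} in
/-- `[φᵏ(a), φˡ(b)] = γ (k+l-m)!_ζ / (k!_ζ l!_ζ) φᵏ⁺ˡ⁻ᵐ[a, b]` for `k + l ≥ m`. -/
theorem phi_lie_phi_of_ge (k l : Fin m) (a b : B) (h : m ≤ (k : ℕ) + l) :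
    ⁅phi m ζ γ k a, phi m ζ γ l b⁆ =
      (γ * (qFactorial ζ (k + l - m) / (qFactorial ζ k * qFactorial ζ l))) •
        phi m ζ γ ⟨k + l - m, by omega⟩ ⁅a, b⁆ := by
  ext i
  rw [phi_lie_phi_apply, smul_apply, coeff]
  have hi := i.2
  rw [if_neg (by omega)]
  by_cases hi' : (k : ℕ) + l = i + m
  · have he : (⟨k + l - m, by omega⟩ : Fin m) = i := Fin.ext (by simp only; omega)
    rw [if_pos hi', he]
    simp [phi]
  · rw [if_neg hi', zero_smul]
    simp only [phi]
    rw [Pi.single_eq_of_ne (fun e => hi' (by rw [e]; simp only; omega)), smul_zero]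

end TaftLie

end

/-! The element `c` acts by automorphisms, so it preserves the radical; `v` is only a skew
derivation and need not. The radical is thus a proper nonzero `c`-invariant ideal. Let A be a
minimal nonzero `c`-invariant ideal inside it. By minimality and `H`-simplicity, no nonzero b ∈ A
has v b ∈ A. Skew-symmetry of the bracket then forces [c a - a, b] = 0 for all a ∈ L, b ∈ A, so (c -
1)L centralizes A. As the center is zero, the centralizer of A is proper and lies in a maximal ideal
K (`exists_isCoatom`). Since L is perfect, S = L/K is simple, and the projection π satisfies π(c x)
= π(x).

The map x ↦ (π(vⁱ x))ᵢ is then an `H`-equivariant Lie morphism L → L(S, 0) (`coordHom`): the quantum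
Leibniz rule for vⁱ, with its powers of `c` erased by π, is the bracket of L(S, 0). Its kernel is an
`H`-invariant ideal, hence zero. It is onto because the elements s with φⁱ(s) in the image form an
ideal of the simple algebra S: degree 0 is reached by averaging over `c`, degree 1 because v ≠ 0 on
L, higher degrees by brackets (`coordHom_surjective`). Finally K consists of the elements without
degree 0 component, so it is nilpotent; being maximal, it is both radicals. -/

namespace TaftAlgebra

/-! ### Linear actions of the Taft algebra -/

section General

variable {F : Type*} [Field F] {m : ℕ} {ζ : F}

/-- A subspace invariant under `c` and `v` is invariant under the whole Taft algebra. -/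
theorem smul_mem_of_c_v {M : Type*} [AddCommGroup M] [Module F M] [Module (TaftAlgebra m ζ) M]
    [IsScalarTower F (TaftAlgebra m ζ) M] (N : Submodule F M)
    (hc : ∀ x ∈ N, c m ζ • x ∈ N) (hv : ∀ x ∈ N, v m ζ • x ∈ N) (h : TaftAlgebra m ζ) :
    ∀ x ∈ N, h • x ∈ N := by
  obtain ⟨p, rfl⟩ := RingQuot.mkAlgHom_surjective F (TaftRel m ζ) h
  change ∀ x ∈ N, mk m ζ p • x ∈ N
  induction p using FreeAlgebra.induction with
  | grade0 r =>
    intro x hx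
    rw [AlgHom.commutes, algebraMap_smul]
    exact N.smul_mem r hx
  | grade1 g =>
    cases g
    · exact hc
    · exact hv
  | mul a b ha hb =>
    intro x hx
    rw [map_mul, mul_smul]
    exact ha _ (hb x hx)
  | add a b ha hb =>
    intro x hx
    rw [map_add, add_smul]
    exact N.add_mem (ha x hx) (hb x hx)

/-- A linear map that commutes with `c` and `v` commutes with the whole Taft algebra. -/
theorem map_smul_of_c_v {M N : Type*} [AddCommGroup M] [Module F M] [Module (TaftAlgebra m ζ) M]
    [IsScalarTower F (TaftAlgebra m ζ) M] [AddCommGroup N] [Module F N]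
    [Module (TaftAlgebra m ζ) N] [IsScalarTower F (TaftAlgebra m ζ) N] (f : M →ₗ[F] N)
    (hc : ∀ x, f (c m ζ • x) = c m ζ • f x) (hv : ∀ x, f (v m ζ • x) = v m ζ • f x)
    (h : TaftAlgebra m ζ) : ∀ x, f (h • x) = h • f x := by
  obtain ⟨p, rfl⟩ := RingQuot.mkAlgHom_surjective F (TaftRel m ζ) h
  change ∀ x, f (mk m ζ p • x) = mk m ζ p • f x
  induction p using FreeAlgebra.induction with
  | grade0 r =>
    intro x
    rw [AlgHom.commutes, algebraMap_smul, algebraMap_smul, map_smul]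
  | grade1 g =>
    cases g
    · exact hc
    · exact hv
  | mul a b ha hb =>
    intro x
    rw [map_mul, mul_smul, mul_smul, ha, hb]
  | add a b ha hb =>
    intro x
    rw [map_add, add_smul, add_smul, map_add, ha, hb]

theorem v_pow_mul_c (n : ℕ) : v m ζ ^ n * c m ζ = ζ ^ n • (c m ζ * v m ζ ^ n) := by
  induction n with
  | zero => simp
  | succ n ih =>
    rw [pow_succ', mul_assoc, ih, mul_smul_comm, ← mul_assoc, v_mul_c, smul_mul_assoc, smul_smul,
      mul_assoc, ← pow_succ]

theorem c_smul_c_pow_smul {M : Type*} [AddCommGroup M] [Module (TaftAlgebra m ζ) M] (hm : m ≠ 0)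
    (x : M) : c m ζ • c m ζ ^ (m - 1) • x = x := by
  rw [← mul_smul, mul_pow_sub_one hm, c_pow, one_smul]

end General

/-! ### Leibniz rules in a module Lie algebra -/

variable {F : Type*} [Field F] {m : ℕ} [NeZero m] {ζ : F} [Fact (IsPrimitiveRoot ζ m)]
  {L : Type*} [LieRing L] [LieAlgebra F L] [Module (TaftAlgebra m ζ) L]
  [IsScalarTower F (TaftAlgebra m ζ) L] [IsModuleLieAlgebra F (TaftAlgebra m ζ) L]

/-- The summands X = c ⊗ v and Y = v ⊗ 1 of Δv satisfy YX = ζXY, so the quantum binomial theorem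
applies. -/
theorem comul_v_pow (n : ℕ) : Coalgebra.comul (R := F) (v m ζ ^ n) =
    ∑ k ∈ Finset.range (n + 1), qPascal ζ n k •
      ((c m ζ ^ k * v m ζ ^ (n - k)) ⊗ₜ[F] (v m ζ ^ k)) := by
  have h : Coalgebra.comul (R := F) (v m ζ ^ n) = Coalgebra.comul (R := F) (v m ζ) ^ n :=
    map_pow (Bialgebra.comulAlgHom F (TaftAlgebra m ζ)) (v m ζ) n
  rw [h, comul_v, qCommute_add_pow ζ]
  · simp only [Algebra.TensorProduct.tmul_pow, Algebra.TensorProduct.tmul_mul_tmul, one_pow,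
      mul_one]
  · simp only [Algebra.TensorProduct.tmul_mul_tmul, v_mul_c, one_mul, mul_one,
      TensorProduct.smul_tmul']

variable (F) in
theorem c_smul_lie (a b : L) : c m ζ • ⁅a, b⁆ = ⁅c m ζ • a, c m ζ • b⁆ := by
  rw [IsModuleLieAlgebra.smul_lie_eq (F := F), comul_c]
  rfl

theorem v_pow_smul_lie (n : ℕ) (a b : L) : v m ζ ^ n • ⁅a, b⁆ =
    ∑ k ∈ Finset.range (n + 1), qPascal ζ n k •
      ⁅c m ζ ^ k • v m ζ ^ (n - k) • a, v m ζ ^ k • b⁆ := by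
  rw [IsModuleLieAlgebra.smul_lie_eq (F := F), comul_v_pow, map_sum]
  refine Finset.sum_congr rfl fun k _ => ?_
  rw [map_smul, ← mul_smul]
  rfl

theorem v_smul_lie (a b : L) :
    v m ζ • ⁅a, b⁆ = ⁅c m ζ • a, v m ζ • b⁆ + ⁅v m ζ • a, b⁆ := by
  rw [IsModuleLieAlgebra.smul_lie_eq (F := F), comul_v, map_add]
  change _ + ⁅v m ζ • a, (1 : TaftAlgebra m ζ) • b⁆ = _
  rw [one_smul]
  rfl

/-- The compatibility of the action of `v` with the antisymmetry of the bracket. -/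
theorem lie_c_sub_v (a b : L) :
    ⁅c m ζ • a - a, v m ζ • b⁆ = ⁅v m ζ • a, c m ζ • b - b⁆ := by
  have h : v m ζ • ⁅a, b⁆ = -(v m ζ • ⁅b, a⁆) := by rw [← smul_neg, lie_skew]
  rw [v_smul_lie, v_smul_lie, neg_add, lie_skew, lie_skew] at h
  rw [sub_lie, lie_sub, sub_eq_sub_iff_add_eq_add, h]

variable (m ζ L) in
/-- The action of `c` is an automorphism of the Lie algebra. -/
noncomputable def cEquiv : L ≃ₗ⁅F⁆ L where
  toFun x := c m ζ • x
  map_add' := smul_add _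
  map_smul' r x := smul_comm _ _ _
  map_lie' := c_smul_lie F _ _
  invFun x := c m ζ ^ (m - 1) • x
  left_inv x := by
    change _ • _ • x = x
    rw [← mul_smul, pow_sub_one_mul (NeZero.ne m), c_pow, one_smul]
  right_inv x := c_smul_c_pow_smul (NeZero.ne m) x

/-- An automorphism carries the radical to a solvable ideal. The image under `c` is written as the
preimage under its inverse, which is an ideal by construction. -/
theorem c_smul_mem_radical [FiniteDimensional F L] {x : L} (hx : x ∈ LieAlgebra.radical F L) :
    c m ζ • x ∈ LieAlgebra.radical F L := by
  set e := (cEquiv m ζ L).symm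
  set J := (LieAlgebra.radical F L).comap e.toLieHom
  have hJ : LieAlgebra.IsSolvable J := by
    let f : J →ₗ⁅F⁆ LieAlgebra.radical F L :=
      { toFun := fun y => ⟨e y, y.2⟩
        map_add' := fun y z => Subtype.ext (map_add e _ _)
        map_smul' := fun r y => Subtype.ext (map_smul e _ _)
        map_lie' := fun {y z} => Subtype.ext (LieEquiv.map_lie e _ _) }
    have hf : Function.Injective f := fun y z h =>
      Subtype.ext (e.injective (congrArg Subtype.val h))
    exact hf.lieAlgebra_isSolvable
  have : e (c m ζ • x) = x := (cEquiv m ζ L).symm_apply_apply x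
  refine (LieAlgebra.LieIdeal.solvable_iff_le_radical F L J).1 hJ (LieIdeal.mem_comap.2 ?_)
  exact (congrArg (· ∈ LieAlgebra.radical F L) this).mpr hx

end TaftAlgebra

/-! ### `H`-simple algebras and their maximal ideals -/

/-- The quotient map by an ideal, as a morphism of Lie algebras. -/
def LieIdeal.quotientHom {R L : Type*} [CommRing R] [LieRing L] [LieAlgebra R L]
    (K : LieIdeal R L) : L →ₗ⁅R⁆ L ⧸ K :=
  { (LieSubmodule.Quotient.mk' K : L →ₗ[R] L ⧸ K) with
    map_lie' := fun {x y} => LieSubmodule.Quotient.mk_bracket K x y }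

theorem LieIdeal.quotientHom_surjective {R L : Type*} [CommRing R] [LieRing L] [LieAlgebra R L]
    (K : LieIdeal R L) : Function.Surjective K.quotientHom :=
  LieSubmodule.Quotient.surjective_mk' K

theorem LieIdeal.quotientHom_eq_zero_iff {R L : Type*} [CommRing R] [LieRing L] [LieAlgebra R L]
    {K : LieIdeal R L} {x : L} : K.quotientHom x = 0 ↔ x ∈ K :=
  LieSubmodule.Quotient.mk_eq_zero K

namespace IsHSimple

variable {F : Type*} [Field F] {m : ℕ} {ζ : F}
  {L : Type*} [LieRing L] [LieAlgebra F L] [Module (TaftAlgebra m ζ) L]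
  [IsScalarTower F (TaftAlgebra m ζ) L]

open TaftAlgebra

theorem eq_bot_or_eq_top_of_c_v (hs : IsHSimple F (TaftAlgebra m ζ) L) (I : LieIdeal F L)
    (hc : ∀ x ∈ I, c m ζ • x ∈ I) (hv : ∀ x ∈ I, v m ζ • x ∈ I) : I = ⊥ ∨ I = ⊤ :=
  hs.eq_bot_or_eq_top I fun h x hx => smul_mem_of_c_v I.toSubmodule hc hv h x hx

variable [NeZero m] [Fact (IsPrimitiveRoot ζ m)] [IsModuleLieAlgebra F (TaftAlgebra m ζ) L]

/-- Both Leibniz rules send a bracket to a sum of brackets, so [L, L] is `H`-invariant, and it is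
nonzero. -/
theorem derivedSeries_one_eq_top (hs : IsHSimple F (TaftAlgebra m ζ) L) :
    LieAlgebra.derivedSeries F L 1 = ⊤ := by
  have key : ∀ h : TaftAlgebra m ζ, (∀ a b : L, h • ⁅a, b⁆ ∈ LieAlgebra.derivedSeries F L 1) →
      ∀ x ∈ LieAlgebra.derivedSeries F L 1, h • x ∈ LieAlgebra.derivedSeries F L 1 := by
    intro h hh x hx
    replace hx : x ∈ Submodule.span F {x : L | ∃ (y z : L), ⁅y, z⁆ = x} :=
      (SetLike.ext_iff.1 (LieAlgebra.coe_derivedSeries_one_eq F L) x).1 hx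
    induction hx using Submodule.span_induction with
    | mem x hx =>
      obtain ⟨a, b, rfl⟩ := hx
      exact hh a b
    | zero => simp
    | add x y _ _ hx hy => rw [smul_add]; exact add_mem hx hy
    | smul r x _ hx => rw [smul_comm]; exact (LieAlgebra.derivedSeries F L 1).smul_mem r hx
  have hmem : ∀ a b : L, ⁅a, b⁆ ∈ LieAlgebra.derivedSeries F L 1 := fun a b =>
    LieSubmodule.lie_mem_lie (LieSubmodule.mem_top a) (LieSubmodule.mem_top b)
  refine (hs.eq_bot_or_eq_top_of_c_v _ (key _ fun a b => ?_)
    (key _ fun a b => ?_)).resolve_left fun h => hs.non_abelian ⟨fun a b => ?_⟩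
  · rw [c_smul_lie F]; exact hmem _ _
  · rw [v_smul_lie (F := F)]; exact add_mem (hmem _ _) (hmem _ _)
  · have := hmem a b
    rwa [h, LieSubmodule.mem_bot] at this

theorem not_isSolvable (hs : IsHSimple F (TaftAlgebra m ζ) L) : ¬ LieAlgebra.IsSolvable L := by
  intro h
  obtain ⟨k, hk⟩ := LieAlgebra.IsSolvable.solvable F L
  rw [LieIdeal.derivedSeries_eq_top k hs.derivedSeries_one_eq_top] at hk
  refine hs.non_abelian ⟨fun a b => ?_⟩
  rw [← LieSubmodule.mem_bot (R := F) (L := L), ← hk]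
  exact LieSubmodule.mem_top _

theorem radical_ne_top [FiniteDimensional F L] (hs : IsHSimple F (TaftAlgebra m ζ) L) :
    LieAlgebra.radical F L ≠ ⊤ := by
  intro h
  have h2 := LieAlgebra.radicalIsSolvable F L
  rw [h] at h2
  refine hs.not_isSolvable ?_
  let f : L →ₗ⁅F⁆ (⊤ : LieIdeal F L) :=
    { toFun := fun y => ⟨y, LieSubmodule.mem_top y⟩
      map_add' := fun y z => rfl
      map_smul' := fun r y => rfl
      map_lie' := fun {y z} => rfl }
  have hf : Function.Injective f := fun y z h => congrArg Subtype.val h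
  exact hf.lieAlgebra_isSolvable

theorem center_eq_bot (hs : IsHSimple F (TaftAlgebra m ζ) L) : LieAlgebra.center F L = ⊥ := by
  have hc : ∀ x ∈ LieAlgebra.center F L, c m ζ • x ∈ LieAlgebra.center F L := by
    intro x hx y
    rw [← c_smul_c_pow_smul (NeZero.ne m) y (ζ := ζ), ← c_smul_lie F, hx, smul_zero]
  refine (hs.eq_bot_or_eq_top_of_c_v _ hc fun x hx y => ?_).resolve_right fun h =>
    hs.non_abelian ((LieAlgebra.isLieAbelian_iff_center_eq_top F L).2 h)
  -- In v[x, y] = [c x, v y] + [v x, y] the left side vanishes, and so does the first term since c x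
  -- is central as well.
  have h1 := v_smul_lie (F := F) (ζ := ζ) (m := m) x y
  rw [← lie_skew, hx y, ← lie_skew (c m ζ • x), hc x hx] at h1
  rw [← lie_skew, neg_eq_zero]
  simpa using h1.symm

theorem isSimple_quotient (hs : IsHSimple F (TaftAlgebra m ζ) L) {K : LieIdeal F L}
    (hK : IsCoatom K) : LieAlgebra.IsSimple F (L ⧸ K) where
  eq_bot_or_eq_top I := by
    have hle : K ≤ I.comap K.quotientHom := fun x hx => by
      rw [LieIdeal.mem_comap, LieIdeal.quotientHom_eq_zero_iff.2 hx]
      exact I.zero_mem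
    rcases hK.le_iff.1 hle with h | h
    · right
      rw [eq_top_iff]
      intro y _
      obtain ⟨x, rfl⟩ := K.quotientHom_surjective y
      rw [← LieIdeal.mem_comap, h]
      exact LieSubmodule.mem_top x
    · left
      rw [eq_bot_iff]
      intro y hy
      obtain ⟨x, rfl⟩ := K.quotientHom_surjective y
      rw [← LieIdeal.mem_comap, h] at hy
      exact (LieSubmodule.mem_bot _).2 (LieIdeal.quotientHom_eq_zero_iff.2 hy)
  non_abelian h := by
    refine hK.1 (top_le_iff.1 ?_)
    rw [← hs.derivedSeries_one_eq_top]
    refine (LieSubmodule.lie_le_iff _ _ _).2 fun x _ y _ => ?_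
    rw [← LieIdeal.quotientHom_eq_zero_iff, LieHom.map_lie]
    exact trivial_lie_zero _ _ _ _

/-- In an `H`-simple Lie algebra that has a proper nonzero `c`-invariant ideal, the image of
`c - 1` lies in a maximal ideal. -/
theorem exists_isCoatom [FiniteDimensional F L] (hs : IsHSimple F (TaftAlgebra m ζ) L)
    (I : LieIdeal F L) (hI : ∀ x ∈ I, c m ζ • x ∈ I) (h0 : I ≠ ⊥) (h1 : I ≠ ⊤) :
    ∃ K : LieIdeal F L, IsCoatom K ∧ ∀ x : L, c m ζ • x - x ∈ K := by
  -- Minimality is only among `c`-invariant ideals; `v`-invariance would force A = L.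
  let s : Set (LieIdeal F L) := {A | (∀ x ∈ A, c m ζ • x ∈ A) ∧ A ≠ ⊥ ∧ A ≤ I}
  obtain ⟨A, ⟨hAc, hA0, hAI⟩, hmin⟩ :=
    (LieSubmodule.wellFoundedLT_of_isArtinian F L L).wf.has_min s ⟨I, hI, h0, le_rfl⟩
  -- These b form a `c`-invariant ideal A' ≤ A. If A' = A, then A is `v`-invariant, contradicting
  -- `H`-simplicity; so A' = 0 by minimality.
  have hvA : ∀ b ∈ A, v m ζ • b ∈ A → b = 0 := by
    let A' : LieIdeal F L :=
      { carrier := {b | b ∈ A ∧ v m ζ • b ∈ A}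
        add_mem' := fun {a b} ha hb => ⟨add_mem ha.1 hb.1, by
          rw [smul_add]; exact add_mem ha.2 hb.2⟩
        zero_mem' := ⟨A.zero_mem, by rw [smul_zero]; exact A.zero_mem⟩
        smul_mem' := fun r b hb => ⟨A.smul_mem r hb.1, by
          rw [smul_comm]; exact A.smul_mem r hb.2⟩
        lie_mem := fun {x b} hb => ⟨lie_mem_right F L A x b hb.1, by
          rw [v_smul_lie (F := F)]
          exact add_mem (lie_mem_right F L A _ _ hb.2) (lie_mem_right F L A _ _ hb.1)⟩ }
    have hA'c : ∀ b ∈ A', c m ζ • b ∈ A' := fun b hb => ⟨hAc b hb.1, by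
      rw [← mul_smul, v_mul_c, smul_assoc, mul_smul]
      exact A.smul_mem ζ (hAc _ hb.2)⟩
    have hle : A' ≤ A := fun b hb => hb.1
    rcases hle.eq_or_lt with h | h
    · exfalso
      rcases hs.eq_bot_or_eq_top_of_c_v A hAc (fun b hb => (h.symm ▸ hb : b ∈ A').2) with h2 | h2
      · exact hA0 h2
      · exact h1 (top_le_iff.1 (h2 ▸ hAI))
    · have : A' = ⊥ := by
        by_contra hne
        exact hmin A' ⟨hA'c, hne, hle.trans hAI⟩ h
      intro b hb hvb
      have hb' : b ∈ A' := ⟨hb, hvb⟩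
      rwa [this, LieSubmodule.mem_bot] at hb'
  -- By `hvA` it suffices that `v` maps this bracket into A. The only doubtful Leibniz term is [c(c
  -- a) - c a, v b], which `lie_c_sub_v` turns into [v(c a), c b - b], a bracket with an element of
  -- A.
  have hann : ∀ a : L, ∀ b ∈ A, ⁅c m ζ • a - a, b⁆ = 0 := by
    intro a b hb
    refine hvA _ (lie_mem_right F L A _ _ hb) ?_
    rw [v_smul_lie (F := F), smul_sub, lie_c_sub_v (F := F)]
    exact add_mem (lie_mem_right F L A _ _ (sub_mem (hAc b hb) hb)) (lie_mem_right F L A _ _ hb)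
  let C : LieIdeal F L :=
    { carrier := {x | ∀ b ∈ A, ⁅x, b⁆ = 0}
      add_mem' := fun {x y} hx hy b hb => by rw [add_lie, hx b hb, hy b hb, add_zero]
      zero_mem' := fun b _ => zero_lie b
      smul_mem' := fun r x hx b hb => by rw [smul_lie, hx b hb, smul_zero]
      lie_mem := fun {x y} hy b hb => by
        rw [lie_lie, hy b hb, hy _ (lie_mem_right F L A _ _ hb), lie_zero, sub_zero] }
  -- If the centralizer of A were all of L, then A would be central, hence zero.
  have hC : C ≠ ⊤ := by
    intro h
    apply hA0
    rw [eq_bot_iff, ← hs.center_eq_bot]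
    intro b hb x
    have hx : x ∈ C := h ▸ LieSubmodule.mem_top x
    exact hx b hb
  obtain ⟨K, hK, hCK⟩ := (eq_top_or_exists_le_coatom C).resolve_left hC
  exact ⟨K, hK, fun x => hCK (hann x)⟩

end IsHSimple

/-! ### Computations in L(S, 0) -/

theorem qFactorial_zero {F : Type*} [Field F] (ζ : F) : qFactorial ζ 0 = 1 :=
  Finset.prod_range_zero _

/-- Links the Leibniz coefficients to the structure constants of L(B, 0). The lower indices l and k
differ by the symmetry of the binomial. -/
theorem qPascal_eq_qBinom {F : Type*} [Field F] {ζ : F} {m : ℕ} (hζ : IsPrimitiveRoot ζ m)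
    {k l : ℕ} (h : k + l < m) : qPascal ζ (k + l) l = qBinom ζ (k + l) k := by
  have h1 := qPascal_mul ζ (k + l) l k (add_comm l k)
  have hk := qFactorial_ne_zero hζ (show k < m by omega)
  have hl := qFactorial_ne_zero hζ (show l < m by omega)
  rw [qBinom, Nat.add_sub_cancel_left, eq_div_iff (mul_ne_zero hl hk), h1]

namespace TaftLie

variable {F : Type*} [Field F] {m : ℕ} {ζ : F} {γ : F}

section Module

variable {S : Type*} [AddCommGroup S]

theorem phi_apply (k i : Fin m) (a : S) :
    phi m ζ γ k a i = if i = k then a else 0 :=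
  Pi.single_apply _ _ _

theorem sum_apply {ι : Type*} (s : Finset ι) (f : ι → TaftLie m ζ S γ) (i : Fin m) :
    (∑ j ∈ s, f j) i = ∑ j ∈ s, f j i := by
  classical
  induction s using Finset.induction_on with
  | empty => rfl
  | insert a s ha ih => rw [Finset.sum_insert ha, Finset.sum_insert ha, add_apply, ih]

theorem sum_phi (f : TaftLie m ζ S γ) : ∑ k, phi m ζ γ k (f k) = f := by
  refine ext_apply fun i => ?_
  rw [sum_apply]
  simp [phi_apply]

theorem phi_add (k : Fin m) (a b : S) :
    phi m ζ γ k (a + b) = phi m ζ γ k a + phi m ζ γ k b := by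
  refine ext_apply fun i => ?_
  rw [add_apply, phi_apply, phi_apply, phi_apply]
  split_ifs <;> simp

theorem phi_smul [Module F S] (k : Fin m) (r : F) (a : S) :
    phi m ζ γ k (r • a) = r • phi m ζ γ k a := by
  refine ext_apply fun i => ?_
  rw [smul_apply, phi_apply, phi_apply]
  split_ifs <;> simp

end Module

variable {S : Type*} [LieRing S] [LieAlgebra F S]

theorem phi_zero_lie_phi [NeZero m] [hζ : Fact (IsPrimitiveRoot ζ m)] (i : Fin m)
    (a b : S) : ⁅phi m ζ γ 0 a, phi m ζ γ i b⁆ = phi m ζ γ i ⁅a, b⁆ := by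
  have h : ((0 : Fin m) : ℕ) + i < m := by simp
  rw [phi_lie_phi_of_lt m ζ γ 0 i a b h]
  have h1 : qBinom ζ (((0 : Fin m) : ℕ) + i) ((0 : Fin m) : ℕ) = 1 := by
    rw [Fin.val_zero, zero_add, qBinom, qFactorial_zero, Nat.sub_zero, mul_one,
      div_self (qFactorial_ne_zero hζ.out i.2)]
  have h2 : (⟨((0 : Fin m) : ℕ) + i, h⟩ : Fin m) = i := Fin.ext (by simp)
  rw [h1, one_smul, h2]

/-- The bracket of `L(B, 0)` as a sum over one index. -/
theorem lie_apply_eq_sum_qPascal (hζ : IsPrimitiveRoot ζ m) (a b : ℕ → S)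
    {f g : TaftLie m ζ S (0 : F)} (hf : ∀ i : Fin m, f i = a i) (hg : ∀ i : Fin m, g i = b i)
    (i : Fin m) :
    ⁅f, g⁆ i = ∑ l ∈ Finset.range (i + 1), qPascal ζ i l • ⁅a (i - l), b l⁆ := by
  rw [lie_apply, Finset.sum_comm]
  have hi := i.2
  -- Since γ = 0 the terms with k + l = i + m vanish, so only k = i - l contributes, and nothing
  -- does when l > i.
  have h1 : ∀ l : Fin m, ∑ k, coeff ζ (0 : F) k l i • ⁅f k, g l⁆ =
      if (l : ℕ) < i + 1 then qPascal ζ i l • ⁅a (i - l), b l⁆ else 0 := by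
    intro l
    split_ifs with h
    · have hk : (i : ℕ) - l < m := by omega
      rw [Finset.sum_eq_single ⟨i - l, hk⟩]
      · have e : (i : ℕ) - l + l = i := by omega
        have h2 := qPascal_eq_qBinom hζ (k := i - l) (l := l) (by omega)
        rw [coeff, if_pos e, hf, hg, ← h2, e]
      · intro k _ hk
        have hk' : (k : ℕ) + l ≠ i := fun e => hk (Fin.ext (by simp only; omega))
        rw [coeff, if_neg hk']
        simp
      · exact fun h => absurd (Finset.mem_univ _) h
    · refine Finset.sum_eq_zero fun k _ => ?_
      rw [coeff, if_neg (by omega)]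
      simp
  rw [Finset.sum_congr rfl fun l _ => h1 l,
    Fin.sum_univ_eq_sum_range
      (fun l => if l < (i : ℕ) + 1 then qPascal ζ i l • ⁅a (i - l), b l⁆ else 0) m,
    ← Finset.sum_filter]
  refine Finset.sum_congr (Finset.ext fun l => ?_) fun _ _ => rfl
  simp only [Finset.mem_filter, Finset.mem_range]
  omega

end TaftLie

/-! ### The coordinate morphism L → L(S, 0) -/

namespace TaftAlgebra

theorem map_c_pow_smul {F : Type*} [Field F] {m : ℕ} {ζ : F} {M T : Type*} [AddCommGroup M]
    [Module (TaftAlgebra m ζ) M] (π : M → T) (hπ : ∀ x, π (c m ζ • x) = π x) (n : ℕ) (x : M) :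
    π (c m ζ ^ n • x) = π x := by
  induction n with
  | zero => rw [pow_zero, one_smul]
  | succ n ih => rw [pow_succ', mul_smul, hπ, ih]

/-- Averages x over the powers of `c`, all of which have the same image under π. -/
theorem exists_c_smul_eq_map_eq {F : Type*} [Field F] [CharZero F] {m : ℕ} [NeZero m] {ζ : F}
    {M T : Type*} [AddCommGroup M] [Module F M] [Module (TaftAlgebra m ζ) M]
    [IsScalarTower F (TaftAlgebra m ζ) M] [AddCommGroup T] [Module F T] (π : M →ₗ[F] T)
    (hπ : ∀ x, π (c m ζ • x) = π x) (x : M) : ∃ y, c m ζ • y = y ∧ π y = π x := by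
  refine ⟨(m : F)⁻¹ • ∑ j ∈ Finset.range m, c m ζ ^ j • x, ?_, ?_⟩
  · rw [smul_comm, Finset.smul_sum]
    congr 1
    simp only [← mul_smul, ← pow_succ']
    have h1 := Finset.sum_range_succ (fun j => c m ζ ^ j • x) m
    rw [Finset.sum_range_succ', pow_zero, c_pow] at h1
    exact add_right_cancel h1
  · rw [map_smul, map_sum, Finset.sum_congr rfl fun j _ => map_c_pow_smul π hπ j x,
      Finset.sum_const, Finset.card_range, ← Nat.cast_smul_eq_nsmul F, smul_smul,
      inv_mul_cancel₀ (Nat.cast_ne_zero.2 (NeZero.ne m)), one_smul]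

variable {F : Type*} [Field F] {m : ℕ} [NeZero m] {ζ : F} [hζ : Fact (IsPrimitiveRoot ζ m)]
  {L : Type*} [LieRing L] [LieAlgebra F L] [Module (TaftAlgebra m ζ) L]
  [IsScalarTower F (TaftAlgebra m ζ) L] [IsModuleLieAlgebra F (TaftAlgebra m ζ) L]
  {S : Type*} [LieRing S] [LieAlgebra F S]

theorem map_v_pow_smul_lie (π : L →ₗ⁅F⁆ S) (hπ : ∀ x, π (c m ζ • x) = π x) (n : ℕ) (x y : L) :
    π (v m ζ ^ n • ⁅x, y⁆) =
    ∑ k ∈ Finset.range (n + 1), qPascal ζ n k • ⁅π (v m ζ ^ (n - k) • x), π (v m ζ ^ k • y)⁆ := by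
  rw [v_pow_smul_lie (F := F), map_sum]
  refine Finset.sum_congr rfl fun k _ => ?_
  rw [map_smul, LieHom.map_lie, map_c_pow_smul π hπ]

variable (π : L →ₗ⁅F⁆ S) (hπ : ∀ x, π (c m ζ • x) = π x)

/-- The morphism `L → L(S, 0)` that a `c`-invariant morphism `π : L → S` induces; its components
are `x ↦ π (vⁱ x)`. -/
noncomputable def coordHom : L →ₗ⁅F⁆ TaftLie m ζ S (0 : F) where
  toFun x := ⟨fun i => π (v m ζ ^ (i : ℕ) • x)⟩
  map_add' x y := TaftLie.ext_apply fun i => by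
    simp only [TaftLie.add_apply, smul_add, map_add]
  map_smul' r x := TaftLie.ext_apply fun i => by
    simp only [TaftLie.smul_apply, smul_comm _ r, map_smul, RingHom.id_apply]
  map_lie' {x y} := TaftLie.ext_apply fun i => by
    refine (map_v_pow_smul_lie π hπ i x y).trans (Eq.symm ?_)
    exact TaftLie.lie_apply_eq_sum_qPascal hζ.out (fun n => π (v m ζ ^ n • x))
      (fun n => π (v m ζ ^ n • y)) (fun _ => rfl) (fun _ => rfl) i

theorem coordHom_apply (x : L) (i : Fin m) :
    coordHom π hπ x i = π (v m ζ ^ (i : ℕ) • x) := rfl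

theorem coordHom_c_smul (x : L) : coordHom π hπ (c m ζ • x) = c m ζ • coordHom π hπ x := by
  refine TaftLie.ext_apply fun i => ?_
  rw [TaftLie.c_smul_apply, coordHom_apply, coordHom_apply, ← mul_smul, v_pow_mul_c, smul_assoc,
    map_smul, mul_smul, hπ]

theorem coordHom_v_smul (x : L) : coordHom π hπ (v m ζ • x) = v m ζ • coordHom π hπ x := by
  refine TaftLie.ext_apply fun i => ?_
  rw [TaftLie.v_smul_apply, coordHom_apply, ← mul_smul, ← pow_succ]
  split_ifs with h
  · rfl
  · rw [show (i : ℕ) + 1 = m by omega, v_pow, zero_smul, map_zero]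

theorem coordHom_smul (h : TaftAlgebra m ζ) (x : L) :
    coordHom π hπ (h • x) = h • coordHom π hπ x :=
  map_smul_of_c_v (coordHom π hπ : L →ₗ[F] TaftLie m ζ S (0 : F)) (coordHom_c_smul π hπ)
    (coordHom_v_smul π hπ) h x

/-- The kernel is an `H`-invariant ideal by equivariance, and not all of L because the degree 0
component is π. -/
theorem coordHom_injective (hs : IsHSimple F (TaftAlgebra m ζ) L) (h0 : ∃ x, π x ≠ 0) :
    Function.Injective (coordHom π hπ) := by
  rw [← LieHom.ker_eq_bot]
  refine (hs.eq_bot_or_eq_top _ fun h x hx => ?_).resolve_right fun h => ?_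
  · rw [LieHom.mem_ker] at hx ⊢
    rw [coordHom_smul, hx, smul_zero]
  · obtain ⟨x, hx⟩ := h0
    have h1 : x ∈ (coordHom π hπ).ker := h ▸ LieSubmodule.mem_top x
    rw [LieHom.mem_ker] at h1
    refine hx ?_
    have h2 := coordHom_apply π hπ x 0
    rw [h1, Fin.val_zero, pow_zero, one_smul] at h2
    exact h2.symm

/-- By equivariance the i-th component is fixed by multiplication by ζⁱ, and ζⁱ ≠ 1 for 0 < i < m.
-/
theorem coordHom_of_c_smul_eq {x : L} (hx : c m ζ • x = x) :
    coordHom π hπ x = TaftLie.phi m ζ (0 : F) 0 (π x) := by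
  refine TaftLie.ext_apply fun i => ?_
  rw [TaftLie.phi_apply]
  split_ifs with hi
  · rw [hi, coordHom_apply, Fin.val_zero, pow_zero, one_smul]
  · have h1 := TaftLie.c_smul_apply m ζ S 0 (coordHom π hπ x) i
    rw [← coordHom_c_smul, hx] at h1
    have h2 : ζ ^ (i : ℕ) ≠ 1 :=
      hζ.out.pow_ne_one_of_pos_of_lt (fun e => hi (Fin.ext (by simpa using e))) i.2
    have h3 : (ζ ^ (i : ℕ) - 1) • coordHom π hπ x i = 0 := by
      rw [sub_smul, one_smul, ← h1, sub_self]
    exact (smul_eq_zero.1 h3).resolve_left (sub_ne_zero.2 h2)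

theorem exists_coordHom_eq_phi_zero [CharZero F] (hsurj : Function.Surjective π) (s : S) :
    ∃ x, coordHom π hπ x = TaftLie.phi m ζ (0 : F) 0 s := by
  obtain ⟨x, rfl⟩ := hsurj s
  obtain ⟨y, hy, hyx⟩ := exists_c_smul_eq_map_eq (π : L →ₗ[F] S) hπ x
  exact ⟨y, (coordHom_of_c_smul_eq π hπ hy).trans (congrArg _ hyx)⟩

/-- The elements `s` of `S` for which `φⁱ(s)` lies in the image of `L`. -/
noncomputable def rangeIdeal [CharZero F] (hsurj : Function.Surjective π) (i : Fin m) :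
    LieIdeal F S where
  carrier := {s | ∃ x, coordHom π hπ x = TaftLie.phi m ζ (0 : F) i s}
  add_mem' := by
    rintro s t ⟨x, hx⟩ ⟨y, hy⟩
    exact ⟨x + y, by rw [map_add, hx, hy, TaftLie.phi_add]⟩
  zero_mem' := ⟨0, by
    rw [map_zero]
    exact TaftLie.ext_apply fun j => by rw [TaftLie.phi_apply, ite_self, TaftLie.zero_apply]⟩
  smul_mem' := by
    rintro r s ⟨x, hx⟩
    exact ⟨r • x, by rw [map_smul, hx, TaftLie.phi_smul]⟩
  lie_mem := by
    rintro t s ⟨x, hx⟩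
    -- Since φ⁰(t) is in the image and brackets with φⁱ(s) to φⁱ[t, s], the set is closed under ad
    -- t.
    obtain ⟨y, hy⟩ := exists_coordHom_eq_phi_zero π hπ hsurj t
    exact ⟨⁅y, x⁆, by rw [LieHom.map_lie, hy, hx, TaftLie.phi_zero_lie_phi]⟩

/-- Nilpotency of `v` yields y with v y ≠ 0 and v² y = 0. Such a y has components only in degrees 0
and 1; subtracting a `c`-fixed z with π z = π y removes the former. -/
theorem exists_coordHom_eq_phi_one [CharZero F] (hm : 1 < m)
    (hinj : Function.Injective (coordHom π hπ)) (hv : ∃ x : L, v m ζ • x ≠ 0) :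
    ∃ s : S, s ≠ 0 ∧ ∃ x, coordHom π hπ x = TaftLie.phi m ζ (0 : F) ⟨1, hm⟩ s := by
  classical
  obtain ⟨x, hx⟩ := hv
  have hex : ∃ k, v m ζ ^ k • x = 0 := ⟨m, by rw [v_pow, zero_smul]⟩
  -- The least power of `v` killing x is at least the second, as v x ≠ 0; then y = vᵏ x.
  obtain ⟨k, hk⟩ : ∃ k, Nat.find hex = k + 2 := by
    refine ⟨Nat.find hex - 2, ?_⟩
    have h1 := Nat.find_spec hex
    by_contra h
    have h2 : Nat.find hex = 0 ∨ Nat.find hex = 1 := by omega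
    rcases h2 with h2 | h2
    · rw [h2, pow_zero, one_smul] at h1
      exact hx (by rw [h1, smul_zero])
    · rw [h2, pow_one] at h1
      exact hx h1
  have h2 : v m ζ ^ 2 • v m ζ ^ k • x = 0 := by
    rw [← mul_smul, ← pow_add, add_comm, ← hk]
    exact Nat.find_spec hex
  have h1 : v m ζ • v m ζ ^ k • x ≠ 0 := by
    rw [← mul_smul, ← pow_succ']
    exact Nat.find_min hex (by omega)
  generalize v m ζ ^ k • x = y at h1 h2
  have hn : ∀ n, 2 ≤ n → v m ζ ^ n • y = 0 := by
    intro n hn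
    rw [show n = n - 2 + 2 by omega, pow_add, mul_smul, h2, smul_zero]
  obtain ⟨z, hz, hzy⟩ : ∃ z, c m ζ • z = z ∧ π z = π y :=
    exists_c_smul_eq_map_eq (π : L →ₗ[F] S) hπ y
  -- The only possibly nonzero component of v y is π(v y), in degree 0, so injectivity excludes π(v
  -- y) = 0.
  refine ⟨π (v m ζ • y), fun h0 => h1 (hinj ?_), y - z, TaftLie.ext_apply fun i => ?_⟩
  · rw [map_zero]
    refine TaftLie.ext_apply fun i => ?_
    rw [coordHom_apply, TaftLie.zero_apply, ← mul_smul, ← pow_succ]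
    rcases Nat.eq_zero_or_pos (i : ℕ) with hi | hi
    · rw [hi, zero_add, pow_one, h0]
    · rw [hn _ (by omega), map_zero]
  · rw [map_sub, coordHom_of_c_smul_eq π hπ hz, sub_eq_add_neg, TaftLie.add_apply,
      TaftLie.neg_apply, TaftLie.phi_apply, TaftLie.phi_apply, coordHom_apply]
    by_cases hi : i = 0
    · subst hi
      have : (0 : Fin m) ≠ ⟨1, hm⟩ := fun h => by simpa using congrArg Fin.val h
      simp [this, hzy]
    · have hi' : (i : ℕ) ≠ 0 := fun e => hi (Fin.ext (by simpa using e))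
      rw [if_neg hi, neg_zero, add_zero]
      split_ifs with h
      · rw [h, pow_one]
      · have h3 : (i : ℕ) ≠ 1 := fun e => h (Fin.ext e)
        rw [hn _ (by omega), map_zero]

theorem coordHom_surjective [CharZero F] (hm : 1 < m) (hS : LieAlgebra.IsSimple F S)
    (hsurj : Function.Surjective π) (hinj : Function.Injective (coordHom π hπ))
    (hv : ∃ x : L, v m ζ • x ≠ 0) : Function.Surjective (coordHom π hπ) := by
  have hne : ∀ i, (∃ s ∈ rangeIdeal π hπ hsurj i, s ≠ 0) → rangeIdeal π hπ hsurj i = ⊤ := by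
    rintro i ⟨s, hs, h0⟩
    refine (hS.eq_bot_or_eq_top _).resolve_left fun h => h0 ?_
    rwa [h, LieSubmodule.mem_bot] at hs
  have hone : rangeIdeal π hπ hsurj ⟨1, hm⟩ = ⊤ := by
    obtain ⟨s, h0, hs⟩ := exists_coordHom_eq_phi_one π hπ hm hinj hv
    exact hne _ ⟨s, hs, h0⟩
  obtain ⟨a, b, hab⟩ : ∃ a b : S, ⁅a, b⁆ ≠ 0 := by
    by_contra! h
    exact hS.non_abelian ⟨h⟩
  have htop : ∀ k (hk : k < m), rangeIdeal π hπ hsurj ⟨k, hk⟩ = ⊤ := by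
    intro k
    induction k with
    | zero =>
      intro hk
      rw [eq_top_iff]
      intro s _
      exact exists_coordHom_eq_phi_zero π hπ hsurj s
    | succ k ih =>
      intro hk
      obtain ⟨x, hx⟩ : a ∈ rangeIdeal π hπ hsurj ⟨1, hm⟩ := hone ▸ LieSubmodule.mem_top a
      obtain ⟨y, hy⟩ : b ∈ rangeIdeal π hπ hsurj ⟨k, by omega⟩ :=
        ih (by omega) ▸ LieSubmodule.mem_top b
      -- [φᵏ(b), φ¹(a)] is this multiple of [b, a] in degree k + 1, with a nonzero quantum binomial
      -- because k + 1 < m.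
      refine hne _ ⟨qBinom ζ (k + 1) k • ⁅b, a⁆, ⟨⁅y, x⁆, ?_⟩, smul_ne_zero ?_ ?_⟩
      · rw [LieHom.map_lie, hx, hy, TaftLie.phi_smul]
        exact TaftLie.phi_lie_phi_of_lt m ζ 0 ⟨k, by omega⟩ ⟨1, hm⟩ b a hk
      · exact div_ne_zero (qFactorial_ne_zero hζ.out hk) (mul_ne_zero
          (qFactorial_ne_zero hζ.out (by omega)) (qFactorial_ne_zero hζ.out (by omega)))
      · rwa [← lie_skew, neg_ne_zero]
  intro f
  have h1 : ∀ i : Fin m, ∃ x, coordHom π hπ x = TaftLie.phi m ζ (0 : F) i (f i) := by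
    intro i
    have : f i ∈ rangeIdeal π hπ hsurj i := by
      rw [htop i i.2]
      exact LieSubmodule.mem_top _
    exact this
  choose x hx using h1
  refine ⟨∑ i, x i, ?_⟩
  rw [map_sum, Finset.sum_congr rfl fun i _ => hx i, TaftLie.sum_phi]

/-! ### Nilpotency of the kernel of π -/

/-- The elements of `L` whose image in `L(S, 0)` has no components of degree below `k`. -/
noncomputable def coordFiltration (k : ℕ) : LieIdeal F L where
  carrier := {x | ∀ i < k, π (v m ζ ^ i • x) = 0}
  add_mem' {x y} hx hy i hi := by rw [smul_add, map_add, hx i hi, hy i hi, add_zero]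
  zero_mem' i _ := by rw [smul_zero, map_zero]
  smul_mem' r x hx i hi := by rw [smul_comm, map_smul, hx i hi, smul_zero]
  lie_mem {x y} hy i hi := by
    rw [map_v_pow_smul_lie π hπ]
    refine Finset.sum_eq_zero fun j hj => ?_
    rw [hy j (by have := Finset.mem_range.1 hj; omega), lie_zero, smul_zero]

/-- Elements of K have no degree 0 component, so bracketing with them raises the lowest degree. -/
theorem lcs_le_coordFiltration (K : LieIdeal F L) (hK : ∀ x ∈ K, π x = 0) (k : ℕ) :
    K.lcs L k ≤ coordFiltration π hπ k := by
  induction k with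
  | zero => exact fun x _ i hi => absurd hi (Nat.not_lt_zero i)
  | succ k ih =>
    rw [LieIdeal.lcs_succ]
    refine (LieSubmodule.lie_le_iff _ _ _).2 fun x hx y hy i hi => ?_
    rw [map_v_pow_smul_lie π hπ]
    refine Finset.sum_eq_zero fun j hj => ?_
    have hj' := Finset.mem_range.1 hj
    by_cases h : j < k
    · rw [ih hy j h, lie_zero, smul_zero]
    -- Here i = j = k, so the left factor is π(x) = 0.
    · rw [show i - j = 0 by omega, pow_zero, one_smul, hK x hx, zero_lie, smul_zero]

theorem isNilpotent_of_map_eq_zero (hinj : Function.Injective (coordHom π hπ)) (K : LieIdeal F L)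
    (hK : ∀ x ∈ K, π x = 0) : LieRing.IsNilpotent K := by
  have h1 : K.lcs L m = ⊥ := by
    rw [eq_bot_iff]
    intro x hx
    have h2 := lcs_le_coordFiltration π hπ K hK m hx
    refine (LieSubmodule.mem_bot x).2 (hinj ?_)
    rw [map_zero]
    exact TaftLie.ext_apply fun i => h2 i i.2
  have h2 : LieModule.IsNilpotent K L := by
    refine (LieModule.isNilpotent_iff F K L).2 ⟨m, ?_⟩
    rw [← LieSubmodule.toSubmodule_inj, ← LieIdeal.coe_lcs_eq, h1]
    rfl
  -- K acts nilpotently on L, hence on itself through this inclusion.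
  let g : K →ₗ[F] L :=
    { toFun := Subtype.val, map_add' := fun _ _ => rfl, map_smul' := fun _ _ => rfl }
  have h3 : Function.Injective g := Subtype.val_injective
  exact h3.lieModuleIsNilpotent (f := (LieHom.id : K →ₗ⁅F⁆ K)) fun _ _ => rfl

end TaftAlgebra

/-! ### Proof of the theorem -/

open TaftAlgebra

theorem mainTheorem1 {F : Type u} [Field F] [IsAlgClosed F] [CharZero F]
    (m : ℕ) [NeZero m] (hm : 2 ≤ m) (ζ : F) [Fact (IsPrimitiveRoot ζ m)]
    {L : Type w} [LieRing L] [LieAlgebra F L] [FiniteDimensional F L]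
    [Module (TaftAlgebra m ζ) L] [IsScalarTower F (TaftAlgebra m ζ) L]
    [IsModuleLieAlgebra F (TaftAlgebra m ζ) L]
    (hsimple : IsHSimple F (TaftAlgebra m ζ) L)
    (hrad : LieAlgebra.radical F L ≠ ⊥) :
    (∃ (B : Type w) (_ : LieRing B) (_ : LieAlgebra F B),
      FiniteDimensional F B ∧ LieAlgebra.IsSimple F B ∧
      (∃ e : L ≃ₗ⁅F⁆ TaftLie m ζ B (0 : F),
        ∀ (h : TaftAlgebra m ζ) (x : L), e (h • x) = h • e x) ∧
      Nonempty (TaftAlgebra.degreeZero m ζ L ≃ₗ⁅F⁆ B)) ∧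
    LieAlgebra.radical F L = lieNilradical F L ∧
    (∀ x : L, TaftAlgebra.v m ζ • x = 0 ↔ x ∈ TaftAlgebra.degreeZero m ζ L) := by
  obtain ⟨K, hK, hcK⟩ := hsimple.exists_isCoatom (LieAlgebra.radical F L)
    (fun x hx => c_smul_mem_radical hx) hrad hsimple.radical_ne_top
  set π := K.quotientHom
  have hπ : ∀ x, π (c m ζ • x) = π x := fun x => by
    rw [← sub_eq_zero, ← map_sub]
    exact LieIdeal.quotientHom_eq_zero_iff.2 (hcK x)
  have hsurj : Function.Surjective π := K.quotientHom_surjective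
  have hS := hsimple.isSimple_quotient hK
  have hinj : Function.Injective (coordHom π hπ) := by
    refine coordHom_injective π hπ hsimple ?_
    by_contra! h
    exact hK.1 (top_le_iff.1 fun x _ => LieIdeal.quotientHom_eq_zero_iff.1 (h x))
  -- Were `v` to act as zero, the radical would be `H`-invariant.
  have hv : ∃ x : L, v m ζ • x ≠ 0 := by
    by_contra! h
    rcases hsimple.eq_bot_or_eq_top_of_c_v (LieAlgebra.radical F L)
      (fun x hx => c_smul_mem_radical hx) (fun x _ => by rw [h]; exact zero_mem _) with h1 | h1
    · exact hrad h1
    · exact hsimple.radical_ne_top h1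
  have hbij : Function.Bijective (coordHom π hπ) :=
    ⟨hinj, coordHom_surjective π hπ (by omega) hS hsurj hinj hv⟩
  refine ⟨⟨L ⧸ K, inferInstance, inferInstance, ?_, hS,
    ⟨LieEquiv.ofBijective (coordHom π hπ) hbij, coordHom_smul π hπ⟩,
    ⟨LieEquiv.ofBijective (π.comp (degreeZero m ζ L).incl) ⟨?_, ?_⟩⟩⟩, ?_, fun x => ⟨?_, ?_⟩⟩
  · exact Module.Finite.of_surjective (π : L →ₗ[F] L ⧸ K) hsurj
  · intro x y hxy
    refine Subtype.ext (hinj ?_)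
    rw [coordHom_of_c_smul_eq π hπ x.2, coordHom_of_c_smul_eq π hπ y.2]
    exact congrArg _ hxy
  · intro s
    obtain ⟨x, rfl⟩ := hsurj s
    obtain ⟨y, hy, hyx⟩ := exists_c_smul_eq_map_eq (π : L →ₗ[F] L ⧸ K) hπ x
    exact ⟨⟨y, hy⟩, hyx⟩
  · have hnil : LieRing.IsNilpotent K := isNilpotent_of_map_eq_zero π hπ hinj K
      fun x hx => LieIdeal.quotientHom_eq_zero_iff.2 hx
    have hle : K ≤ lieNilradical F L := le_sSup hnil
    have hle' : lieNilradical F L ≤ LieAlgebra.radical F L := by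
      refine sSup_le fun I hI => ?_
      have : LieRing.IsNilpotent I := hI
      exact (LieAlgebra.LieIdeal.solvable_iff_le_radical F L I).1 inferInstance
    refine le_antisymm ?_ hle'
    -- K lies in the nilradical, which lies in the radical; K is maximal and the radical is proper,
    -- so all three coincide.
    rcases hK.le_iff.1 (hle.trans hle') with h | h
    · exact absurd h hsimple.radical_ne_top
    · exact h.le.trans hle
  · intro hx
    change c m ζ • x = x
    -- If v x = 0, all components of positive degree vanish, and `c` is the identity in degree 0.
    refine hinj (TaftLie.ext_apply fun i => ?_)
    rw [coordHom_c_smul, TaftLie.c_smul_apply]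
    rcases Nat.eq_zero_or_pos (i : ℕ) with hi | hi
    · rw [hi, pow_zero, one_smul]
    · rw [coordHom_apply, show (i : ℕ) = i - 1 + 1 by omega, pow_succ (v m ζ), mul_smul, hx,
        smul_zero, map_zero, smul_zero]
  · intro hx
    have hx' : c m ζ • x = x := hx
    refine hinj ?_
    rw [coordHom_v_smul, coordHom_of_c_smul_eq π hπ hx', map_zero]
    refine TaftLie.ext_apply fun i => ?_
    rw [TaftLie.v_smul_apply, TaftLie.zero_apply]
    split_ifs with h
    · rw [TaftLie.phi_apply, if_neg fun e => by simpa using congrArg Fin.val e]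
    · rfl
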